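/- Let $(Y,d_0)$ be a separable metric space such that every connected subset of $Y$ with more than one point has nonempty interior. Let $m\ge 1$, and let $M\subset Y^m$ (with the product topology) be nonempty, compact and connected. Let $P=(p_{ij})$ be a $k\times k$ transition matrix (nonnegative entries, row sums $1$) that is primitive (some power of $P$ has only positive entries), and let $\bar p=(p_1,\dots,p_k)$ be its stationary probability vector, $\bar pP=\bar p$; all $p_i$ are then positive. Let $f_1,\dots,f_k\colon M\to M$ be continuous. For $\omega=(\omega_0,\omega_1,\dots)\in\Sigma_k=\{1,\dots,k\}^{\mathbb N}$ write $f_\omega^n=f_{\omega_{n-1}}\circ\dots\circ f_{\omega_0}$, with $f^0_\omega=\mathrm{id}$. Suppose that the splitting condition holds: there are nonempty finite sequences $(a_1,\dots,a_\ell)$ and $(b_1,\dots,b_r)$ in $\{1,\dots,k\}$ with $p_{a_ia_{i+1}}>0$ for $1\le i<\ell$, $p_{b_ib_{i+1}}>0$ for $1\le i<r$ and $a_\ell=b_r$, such that $M_1=f_{a_\ell}\circ\dots\circ f_{a_1}(M)$ and $M_2=f_{b_r}\circ\dots\circ f_{b_1}(M)$ satisfy $$\pi_s(f_\omega^n(M_1))\cap\pi_s(f_\omega^n(M_2))=\emptyset$$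 for every $\omega\in\Sigma_k$, every $n\ge 0$ and every coordinate projection $\pi_s\colon Y^m\to Y$, $s=1,\dots,m$. The Markov operator $T$ on Borel probability measures on $\widehat M=\{1,\dots,k\}\times M$ is $$T\mu(B)=\int\sum_{j=1}^k p_{ij}\,\mathbf 1_B(j,f_j(z))\,d\mu(i,z).$$ Let $\mathbb P^-$ be the inverse Markov measure, i.e. the law on $\Sigma_k$ of the Markov chain with initial law $\bar p$ and transition matrix $Q=(q_{ij})$, $q_{ij}=\frac{p_j}{p_i}p_{ji}$. Let $S\subset\Sigma_k$ be the set of those $\omega$ for which $\bigcap_{n\ge0}f_{\omega_0}\circ\dots\circ f_{\omega_n}(M)$ is a single point. Then $T$ is asymptotically stable: there is a probability measure $\mu$ on $\widehat M$ with $T\mu=\mu$ such that $T^n\nu\to\mu$ in the weak-$*$ topology for every probability measure $\nu$ on $\widehat M$, and $\mu$ is the only probability measure with $T\mu=\mu$. Moreover, $\mathbb P^-(S)=1$; for every $\omega\in S$ the limit $$\pi(\omega)=\lim_{n\to\infty}f_{\omega_0}\circ\dots\circ f_{\omega_n}(x)$$ exists for every $x\in M$ and does not depend on $x$; the map $\omega\mapsto(\omega_0,\pi(\omega))$,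 defined $\mathbb P^-$-almost everywhere, is $\mathbb P^-$-measurable; and $\mu$ is the pushforward of $\mathbb P^-$ by this map. -/

import Mathlib

open MeasureTheory ProbabilityTheory Filter Topology
open scoped Matrix

noncomputable section

namespace MarkovProduct

/-! ### Markov shifts on finitely many symbols -/

/-- The data of a Markov shift on the sequence space `ℕ → Fin k`: a transition matrix `P` and a
stationary probability vector `p` of `P`. The associated Markov measure on `ℕ → Fin k` is
constructed below as `MarkovShift.measure`. -/
structure MarkovShift (k : ℕ) where
  /-- the transition matrix -/
  P : Matrix (Fin k) (Fin k) ℝ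
  /-- the starting vector -/
  p : Fin k → ℝ
  P_mem : P ∈ Matrix.rowStochastic ℝ (Fin k)
  p_mem : p ∈ stdSimplex ℝ (Fin k)
  stationary : p ᵥ* P = p

variable {k : ℕ}

/-- The measure on `Fin k` that gives mass `v i` to the point `i`. -/
def vectorMeasure (v : Fin k → ℝ) : Measure (Fin k) :=
  ∑ i, ENNReal.ofReal (v i) • Measure.dirac i

theorem isProbabilityMeasure_vectorMeasure {v : Fin k → ℝ} (hv : v ∈ stdSimplex ℝ (Fin k)) :
    IsProbabilityMeasure (vectorMeasure v) := by
  constructor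
  simp only [vectorMeasure, Measure.coe_finsetSum, Finset.sum_apply, Measure.smul_apply,
    measure_univ, smul_eq_mul, mul_one]
  rw [← ENNReal.ofReal_sum_of_nonneg fun i _ => hv.1 i, hv.2, ENNReal.ofReal_one]

namespace MarkovShift

variable (S : MarkovShift k)

theorem row_mem (i : Fin k) : S.P i ∈ stdSimplex ℝ (Fin k) :=
  ⟨fun j => S.P_mem.1 i j, Matrix.sum_row_of_mem_rowStochastic S.P_mem i⟩

/-- The transition probability on `Fin k` given by the matrix: `P(i, A) = ∑ j ∈ A, P i j`. -/
def stepKernel : Kernel (Fin k) (Fin k) :=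
  Kernel.ofFunOfCountable fun i => vectorMeasure (S.P i)

instance : IsMarkovKernel S.stepKernel :=
  ⟨fun i => isProbabilityMeasure_vectorMeasure (S.row_mem i)⟩

/-- The transition from the past `(ω 0, …, ω n)` to `ω (n + 1)`; it depends on `ω n` only. -/
def pastKernel (n : ℕ) : Kernel (Π _ : Finset.Iic n, Fin k) (Fin k) :=
  S.stepKernel.comap (fun h => h ⟨n, Finset.mem_Iic.2 le_rfl⟩) (measurable_pi_apply _)

instance (n : ℕ) : IsMarkovKernel (S.pastKernel n) := by
  unfold pastKernel; infer_instance

/-- The Markov measure of `(P, p)`: the law on `ℕ → Fin k` of the homogeneous Markov chain with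
transition matrix `P` and initial law `p`. -/
def measure : Measure (ℕ → Fin k) :=
  Kernel.trajMeasure (X := fun _ => Fin k) (vectorMeasure S.p) S.pastKernel

instance : IsProbabilityMeasure S.measure := by
  have := isProbabilityMeasure_vectorMeasure S.p_mem
  unfold measure; infer_instance

/-- Some power of the transition matrix has only positive entries. -/
def IsPrimitive : Prop := S.P.IsPrimitive

theorem IsPrimitive.pos {S : MarkovShift k} (hS : S.IsPrimitive) (i : Fin k) : 0 < S.p i := by
  obtain ⟨n, -, hn⟩ := hS.exists_pos_pow
  have h : ∀ n : ℕ, S.p ᵥ* S.P ^ n = S.p := by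
    intro n
    induction n with
    | zero => simp
    | succ n ih => rw [pow_succ, ← Matrix.vecMul_vecMul, ih, S.stationary]
  obtain ⟨j, hj⟩ : ∃ j, 0 < S.p j := by
    by_contra! hc
    have := S.p_mem.2
    have h2 : ∑ x, S.p x ≤ 0 := Finset.sum_nonpos fun j _ => hc j
    linarith
  rw [← h n]
  exact Finset.sum_pos' (fun j _ => mul_nonneg (S.p_mem.1 j) (hn j i).le)
    ⟨j, Finset.mem_univ j, mul_pos hj (hn j i)⟩

/-- The inverse Markov shift of `(P, p)`, for a positive vector `p`: its transition matrix is
`Q i j = (p j / p i) * P j i`, its stationary vector is again `p`. Its Markov measure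
`(S.inverse hp).measure` is the inverse Markov measure. -/
def inverse (hp : ∀ i, 0 < S.p i) : MarkovShift k where
  P := Matrix.of fun i j => S.p j / S.p i * S.P j i
  p := S.p
  P_mem := by
    rw [Matrix.mem_rowStochastic_iff_sum]
    refine ⟨fun i j => mul_nonneg (div_nonneg (hp j).le (hp i).le) (S.P_mem.1 j i), fun i => ?_⟩
    have h := congrFun S.stationary i
    simp only [Matrix.vecMul, dotProduct] at h
    simp only [Matrix.of_apply, div_mul_eq_mul_div]
    rw [← Finset.sum_div, h, div_self (hp i).ne']
  p_mem := S.p_mem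
  stationary := by
    ext j
    simp only [Matrix.vecMul, dotProduct, Matrix.of_apply]
    have h : ∀ i, S.p i * (S.p j / S.p i * S.P j i) = S.p j * S.P j i := fun i => by
      have := (hp i).ne'
      field_simp
    simp only [h]
    rw [← Finset.mul_sum, Matrix.sum_row_of_mem_rowStochastic S.P_mem, mul_one]

end MarkovShift

/-! ### Random products and the Markov operator -/

section RandomProduct

variable {X : Type*} [TopologicalSpace X]

/-- The random product `f_ω^n = f_{ω (n-1)} ∘ ⋯ ∘ f_{ω 0}`. -/
def randomProduct (f : Fin k → C(X, X)) (ω : ℕ → Fin k) : ℕ → X → X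
  | 0 => id
  | n + 1 => f (ω n) ∘ randomProduct f ω n

/-- The reversed product `f_{ω 0} ∘ ⋯ ∘ f_{ω (n-1)}`. -/
def reverseProduct (f : Fin k → C(X, X)) (ω : ℕ → Fin k) : ℕ → X → X
  | 0 => id
  | n + 1 => reverseProduct f ω n ∘ f (ω n)

/-- For a finite word `a = (a₁, …, a_ℓ)`, the map `f_{a_ℓ} ∘ ⋯ ∘ f_{a₁}`. -/
def wordMap (f : Fin k → C(X, X)) (a : List (Fin k)) (x : X) : X :=
  a.foldl (fun y i => f i y) x

/-- The fibre `I_ω = ⋂ n, f_{ω 0} ∘ ⋯ ∘ f_{ω n} (X)`. -/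
def fibre (f : Fin k → C(X, X)) (ω : ℕ → Fin k) : Set X :=
  ⋂ n : ℕ, Set.range (reverseProduct f ω (n + 1))

/-- The set of weakly hyperbolic sequences: those whose fibre is a singleton. -/
def weaklyHyperbolic (f : Fin k → C(X, X)) : Set (ℕ → Fin k) :=
  {ω | ∃ z, fibre f ω = {z}}

/-- The coding map `π(ω) = lim f_{ω 0} ∘ ⋯ ∘ f_{ω n} (x)` computed from the base point `x`; it is
meaningful on weakly hyperbolic sequences, where it does not depend on `x`. -/
def codingMap (f : Fin k → C(X, X)) (x : X) (ω : ℕ → Fin k) : X :=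
  haveI : Nonempty X := ⟨x⟩
  limUnder atTop fun n : ℕ => reverseProduct f ω (n + 1) x

variable [MeasurableSpace X] [BorelSpace X]

/-- The transition probability on `Fin k × X` of the random product:
`((i, z), B) ↦ P(i, {j | (j, f j z) ∈ B})`. -/
def productKernel (S : MarkovShift k) (f : Fin k → C(X, X)) : Kernel (Fin k × X) (Fin k × X) where
  toFun := fun q : Fin k × X => (S.stepKernel q.1).map fun j => (j, f j q.2)
  measurable' := by
    refine measurable_from_prod_countable_right fun i => ?_
    refine Measure.measurable_of_measurable_coe _ fun B hB => ?_
    have h : ∀ z : X, ((S.stepKernel i).map fun j => (j, f j z)) B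
        = ∑ j, ENNReal.ofReal (S.P i j) * B.indicator 1 (j, f j z) := by
      intro z
      rw [Measure.map_apply (measurable_of_countable _) hB]
      simp only [MarkovShift.stepKernel, Kernel.ofFunOfCountable, Kernel.coe_mk, vectorMeasure,
        Measure.coe_finsetSum, Finset.sum_apply, Measure.smul_apply, smul_eq_mul]
      refine Finset.sum_congr rfl fun j _ => ?_
      rw [Measure.dirac_apply]
      rfl
    simp only [h]
    refine Finset.measurable_sum _ fun j _ => Measurable.const_mul ?_ _
    exact (measurable_one.indicator hB).comp
      (measurable_const.prodMk (f j).continuous.measurable)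

instance (S : MarkovShift k) (f : Fin k → C(X, X)) : IsMarkovKernel (productKernel S f) :=
  ⟨fun q => Measure.isProbabilityMeasure_map (measurable_of_countable _).aemeasurable⟩

/-- The Markov operator `T μ (B) = ∫ P̂((i, z), B) dμ(i, z)` on the probability measures on
`Fin k × X`. -/
def markovOperator (S : MarkovShift k) (f : Fin k → C(X, X))
    (μ : ProbabilityMeasure (Fin k × X)) : ProbabilityMeasure (Fin k × X) :=
  ⟨(μ : Measure (Fin k × X)).bind (productKernel S f), inferInstance⟩

end RandomProduct

/-! ### The splitting condition -/

section Splitting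

variable {Y : Type*} [TopologicalSpace Y] {m : ℕ} {M : Set (Fin m → Y)}

/-- A word `a = (a₁, …, a_ℓ)` is admissible if `P a_i a_{i+1} > 0` for `1 ≤ i < ℓ`. -/
def Admissible (P : Matrix (Fin k) (Fin k) ℝ) (a : List (Fin k)) : Prop :=
  a.IsChain fun i j => 0 < P i j

/-- The splitting condition: there are (nonempty) admissible words `a`, `b` with the same last
letter such that, with `M₁ = f_{a_ℓ} ∘ ⋯ ∘ f_{a₁} (M)` and `M₂ = f_{b_r} ∘ ⋯ ∘ f_{b₁} (M)`, the sets
`f_ω^n (M₁)` and `f_ω^n (M₂)` have disjoint projections to every coordinate, for all `ω`, `n`. -/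
def Splits (S : MarkovShift k) (f : Fin k → C(M, M)) : Prop :=
  ∃ (a b : List (Fin k)) (ha : a ≠ []) (hb : b ≠ []),
    Admissible S.P a ∧ Admissible S.P b ∧ a.getLast ha = b.getLast hb ∧
    ∀ (ω : ℕ → Fin k) (n : ℕ) (s : Fin m),
      Disjoint
        ((fun x : M => (x : Fin m → Y) s) ''
          (randomProduct f ω n '' (wordMap f a '' Set.univ)))
        ((fun x : M => (x : Fin m → Y) s) ''
          (randomProduct f ω n '' (wordMap f b '' Set.univ)))

end Splitting

/-- For separable metric `Y`, the product sigma-algebra on `Y ^ m` is the Borel sigma-algebra. -/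
instance borelSpace_pow {Y : Type*} [MetricSpace Y] [TopologicalSpace.SeparableSpace Y]
    [MeasurableSpace Y] [BorelSpace Y] (m : ℕ) : BorelSpace (Fin m → Y) := by
  have : SecondCountableTopology Y := UniformSpace.secondCountable_of_separable Y
  infer_instance

/-- `T μ = μ`, and `T ^ n ν → μ` in the weak-* topology for every probability measure `ν`. The
operator `T` is asymptotically stable if such a `μ` exists; `μ` is the stable limit of `T`. -/
def IsStableLimit {Z : Type*} [TopologicalSpace Z] [MeasurableSpace Z]
    [OpensMeasurableSpace Z] (T : ProbabilityMeasure Z → ProbabilityMeasure Z)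
    (μ : ProbabilityMeasure Z) : Prop :=
  T μ = μ ∧ ∀ ν : ProbabilityMeasure Z, Tendsto (fun n : ℕ => T^[n] ν) atTop (𝓝 μ)

end MarkovProduct

end

/-!
The weak hyperbolicity of almost every sequence carries the theorem; stability follows from it by
time reversal.

*Weak hyperbolicity.* For a set `C`, the image of `f_{ω 0} ∘ ⋯ ∘ f_{ω n}` meets `C` if and only if
the image of `f_{ω 1} ∘ ⋯ ∘ f_{ω n}` meets the preimage of `C` under `f_{ω 0}`. The probability of
this event under a Markov measure is therefore given by a recursion on `n` that replaces `C` by its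
preimages (`hitProb`, `measureReal_range_reverseProduct_inter`). By the splitting condition, the
sets `{x | x s = d}` and all their preimages under random products avoid at least one of `M₁` and `M₂`.
The inverse chain reads the words `a` and `b` backwards and, by primitivity, reaches their common
last letter from every state in the same number of steps. Hence, within a fixed number of steps, the
image fails to meet such a set with probability bounded below, and the hitting probabilities decay
exponentially, uniformly over the family (`exists_hitProb_le_pow`). So for each point `d` of a
countable dense subset of `Y` and each coordinate `s`, almost every fibre avoids `{x | x s = d}`. If
a fibre had two points, its projection to some coordinate would be a nondegenerate connected set,
which has interior and so contains some such `d` (`Splits.ae_mem_weaklyHyperbolic`).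

*Stability.* Let `U` be the dual of the Markov operator, acting on continuous functions. Reversing
time, `p i * (U ^ n φ) (i, z)` is the expectation of `φ (ω 0, f_{ω 0} ∘ ⋯ ∘ f_{ω (n - 1)} z)` over
the event `ω n = i` for the inverse Markov measure (`mul_iterate_dualOperator`). The integrand
converges to `φ (ω 0, π ω)`, and the inverse chain is mixing (`IsPrimitive.tendsto_pow`), so
`U ^ n φ` converges pointwise to the integral of `φ` against the law of `(ω 0, π ω)`
(`tendsto_iterate_dualOperator`). By dominated convergence this law is the stable limit
(`isStableLimit_of_tendsto_dualOperator`).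
-/

namespace MarkovProduct

variable {k : ℕ}

/-! ### Expectations under Markov measures -/

/-- The limit `l` of such a sequence satisfies `0 ≤ l ≤ c * l`. -/
theorem tendsto_zero_of_antitone_of_contract {a : ℕ → ℝ} (ha : Antitone a) (h0 : ∀ n, 0 ≤ a n)
    {N : ℕ} {c : ℝ} (hc : c < 1) (h : ∀ n, a (n + N) ≤ c * a n) :
    Tendsto a atTop (𝓝 0) := by
  have hlim := tendsto_atTop_ciInf ha ⟨0, by rintro _ ⟨n, rfl⟩; exact h0 n⟩
  have h1 := ge_of_tendsto' hlim h0
  have h2 := le_of_tendsto_of_tendsto' ((tendsto_add_atTop_iff_nat N).2 hlim) (hlim.const_mul c) h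
  have h3 : (⨅ n, a n) = 0 := by nlinarith
  rwa [h3] at hlim

theorem integral_vectorMeasure {v : Fin k → ℝ} (hv : ∀ i, 0 ≤ v i) (h : Fin k → ℝ) :
    ∫ i, h i ∂(vectorMeasure v) = ∑ i, v i * h i := by
  rw [vectorMeasure, integral_finsetSum_measure]
  · refine Finset.sum_congr rfl fun i _ => ?_
    rw [integral_smul_measure, integral_dirac, ENNReal.toReal_ofReal (hv i), smul_eq_mul]
  · exact fun i _ => Integrable.smul_measure .of_finite ENNReal.ofReal_ne_top

/-- Restricting a sequence to its letters up to time `r` loses no information on functions of these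
letters; the index `min n r` only serves to extend words to sequences. -/
theorem DependsOn.eq_comp_frestrictLe {α : Type*} {G : (ℕ → Fin k) → α} {r : ℕ}
    (hG : DependsOn G (Set.Iic r)) :
    G = (fun h : (Π _ : Finset.Iic r, Fin k) =>
      G fun n => h ⟨min n r, Finset.mem_Iic.2 (min_le_right n r)⟩) ∘ Preorder.frestrictLe r := by
  ext1 ω
  refine hG fun i hi => ?_
  simp [min_eq_left (Set.mem_Iic.1 hi)]

theorem measurable_of_dependsOn {α : Type*} [MeasurableSpace α] {G : (ℕ → Fin k) → α} {r : ℕ}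
    (hG : DependsOn G (Set.Iic r)) : Measurable G := by
  rw [DependsOn.eq_comp_frestrictLe hG]
  exact (measurable_of_countable _).comp (Preorder.measurable_frestrictLe r)

theorem integrable_of_dependsOn (μ : Measure (ℕ → Fin k)) [IsFiniteMeasure μ]
    {G : (ℕ → Fin k) → ℝ} {r : ℕ} (hG : DependsOn G (Set.Iic r)) : Integrable G μ := by
  rw [DependsOn.eq_comp_frestrictLe hG]
  exact Integrable.comp_measurable .of_finite (Preorder.measurable_frestrictLe r)

namespace MarkovShift

variable (S : MarkovShift k)

theorem nonneg (i j : Fin k) : 0 ≤ S.P i j := S.P_mem.1 i j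

theorem sum_row (i : Fin k) : ∑ j, S.P i j = 1 := Matrix.sum_row_of_mem_rowStochastic S.P_mem i

/-- The Markov property: conditionally on `ω 0, …, ω r`, the letter `ω (r + 1)` has law
`P (ω r, ·)`. -/
theorem integral_succ (r : ℕ) (H : (ℕ → Fin k) → Fin k → ℝ)
    (hH : ∀ j, DependsOn (fun ω => H ω j) (Set.Iic r)) :
    ∫ ω, H ω (ω (r + 1)) ∂S.measure = ∫ ω, ∑ j, S.P (ω r) j * H ω j ∂S.measure := by
  have := isProbabilityMeasure_vectorMeasure S.p_mem
  set e : (Π _ : Finset.Iic r, Fin k) → ℕ → Fin k :=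
    fun h n => h ⟨min n r, Finset.mem_Iic.2 (min_le_right n r)⟩
  have hHe : ∀ ω j, H ω j = H (e (Preorder.frestrictLe r ω)) j := fun ω j =>
    congrFun (DependsOn.eq_comp_frestrictLe (hH j)) ω
  have key := Kernel.map_frestrictLe_trajMeasure_compProd_eq_map_trajMeasure
    (X := fun _ => Fin k) (μ₀ := vectorMeasure S.p) (κ := S.pastKernel) (a := r)
  have hint := congrArg (fun μ : Measure ((Π _ : Finset.Iic r, Fin k) × Fin k) =>
    ∫ q, H (e q.1) q.2 ∂μ) key
  have hprob : IsProbabilityMeasure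
      (S.measure.map (Preorder.frestrictLe (π := fun _ => Fin k) r)) :=
    Measure.isProbabilityMeasure_map (Preorder.measurable_frestrictLe r).aemeasurable
  change ∫ q, H (e q.1) q.2 ∂((S.measure.map (Preorder.frestrictLe r)) ⊗ₘ S.pastKernel r)
    = ∫ q, H (e q.1) q.2 ∂(S.measure.map fun x => (Preorder.frestrictLe r x, x (r + 1))) at hint
  rw [Measure.integral_compProd .of_finite,
    integral_map (Preorder.measurable_frestrictLe r).aemeasurable
      (measurable_of_countable _).aestronglyMeasurable,
    integral_map (by fun_prop) (measurable_of_countable _).aestronglyMeasurable] at hint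
  simp only [← hHe] at hint
  rw [← hint]
  refine integral_congr_ae (ae_of_all _ fun ω => ?_)
  exact integral_vectorMeasure (fun j => S.nonneg _ j) _

theorem map_eval_zero : S.measure.map (fun ω => ω 0) = vectorMeasure S.p := by
  have := isProbabilityMeasure_vectorMeasure S.p_mem
  have h0 : (fun ω : ℕ → Fin k => ω 0) =
      MeasurableEquiv.piUnique (fun _ : Finset.Iic 0 => Fin k) ∘ Preorder.frestrictLe 0 := by
    ext1 ω
    rfl
  rw [h0, ← Measure.map_map (by fun_prop) (by fun_prop), measure, Kernel.trajMeasure,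
    Measure.map_comp _ _ (by fun_prop), Kernel.traj_map_frestrictLe, Kernel.partialTraj_self,
    Measure.id_comp, Measure.map_map (by fun_prop) (by fun_prop), MeasurableEquiv.self_comp_symm,
    Measure.map_id]

theorem integral_eval_zero (h : Fin k → ℝ) :
    ∫ ω, h (ω 0) ∂S.measure = ∑ i, S.p i * h i := by
  rw [← integral_vectorMeasure S.p_mem.1, ← S.map_eval_zero,
    integral_map (measurable_pi_apply 0).aemeasurable
      (measurable_of_countable _).aestronglyMeasurable]

/-- The Markov property over `m` steps. -/
theorem integral_add (r m : ℕ) (G : (ℕ → Fin k) → ℝ) (hG : DependsOn G (Set.Iic r))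
    (h : Fin k → ℝ) :
    ∫ ω, G ω * h (ω (r + m)) ∂S.measure = ∫ ω, G ω * ((S.P ^ m) *ᵥ h) (ω r) ∂S.measure := by
  induction m generalizing h with
  | zero => simp
  | succ m ih =>
    have h1 := S.integral_succ (r + m) (fun ω j => G ω * h j) fun j x y hxy => by
      simp only
      rw [hG fun i hi => hxy i (le_trans (Set.mem_Iic.1 hi) (Nat.le_add_right r m))]
    rw [← add_assoc, h1, pow_succ, ← Matrix.mulVec_mulVec, ← ih]
    refine integral_congr_ae (ae_of_all _ fun ω => ?_)
    simp only [Matrix.mulVec, dotProduct, Finset.mul_sum]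
    exact Finset.sum_congr rfl fun j _ => by ring

theorem inverse_pow_apply (hp : ∀ i, 0 < S.p i) (n : ℕ) (i j : Fin k) :
    ((S.inverse hp).P ^ n) i j = S.p j / S.p i * (S.P ^ n) j i := by
  induction n generalizing i j with
  | zero =>
    by_cases h : i = j
    · subst h; simp [(hp i).ne']
    · simp [h, Ne.symm h]
  | succ n ih =>
    rw [pow_succ, pow_succ', Matrix.mul_apply, Matrix.mul_apply, Finset.mul_sum]
    refine Finset.sum_congr rfl fun l _ => ?_
    rw [ih]
    have h : (S.inverse hp).P l j = S.p j / S.p l * S.P j l := rfl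
    rw [h]
    have := (hp i).ne'
    have := (hp l).ne'
    field_simp

theorem IsPrimitive.inverse {S : MarkovShift k} (hS : S.IsPrimitive) :
    (S.inverse hS.pos).IsPrimitive := by
  obtain ⟨n, hn0, hn⟩ := hS.exists_pos_pow
  refine ⟨(S.inverse hS.pos).nonneg, n, hn0, fun i j => ?_⟩
  rw [S.inverse_pow_apply]
  exact mul_pos (div_pos (hS.pos _) (hS.pos _)) (hn j i)

theorem vecMul_pow (n : ℕ) : S.p ᵥ* S.P ^ n = S.p := by
  induction n with
  | zero => simp
  | succ n ih => rw [pow_succ, ← Matrix.vecMul_vecMul, ih, S.stationary]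

/-- On vectors of `p`-mean zero, a power `P ^ N` with entries at least `δ` contracts the supremum
norm by `1 - δ`: it acts on them like `P ^ N - δ • (1 ⊗ p)`, which is nonnegative with row sums
`1 - δ`. -/
theorem norm_pow_mulVec_le {N : ℕ} {δ : ℝ} (hδ0 : 0 ≤ δ) (hδ : ∀ i j, δ ≤ (S.P ^ N) i j)
    {w : Fin k → ℝ} (hw : S.p ⬝ᵥ w = 0) : ‖(S.P ^ N) *ᵥ w‖ ≤ (1 - δ) * ‖w‖ := by
  have hsum : ∀ i, ∑ j, ((S.P ^ N) i j - δ * S.p j) = 1 - δ := fun i => by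
    rw [Finset.sum_sub_distrib, Matrix.sum_row_of_mem_rowStochastic (pow_mem S.P_mem N),
      ← Finset.mul_sum, S.p_mem.2, mul_one]
  have hpos : ∀ i j, 0 ≤ (S.P ^ N) i j - δ * S.p j := fun i j => by
    have h1 : S.p j ≤ 1 := S.p_mem.2 ▸
      Finset.single_le_sum (fun l _ => S.p_mem.1 l) (Finset.mem_univ j)
    have := hδ i j
    nlinarith
  have hδ1 : 0 ≤ 1 - δ := by
    obtain ⟨i⟩ : Nonempty (Fin k) := by
      by_contra hk
      have := S.p_mem.2
      rw [not_nonempty_iff] at hk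
      simp at this
    rw [← hsum i]
    exact Finset.sum_nonneg fun j _ => hpos i j
  refine (pi_norm_le_iff_of_nonneg (mul_nonneg hδ1 (norm_nonneg w))).2 fun i => ?_
  have h : ((S.P ^ N) *ᵥ w) i = ∑ j, ((S.P ^ N) i j - δ * S.p j) * w j := by
    simp only [dotProduct] at hw
    simp only [Matrix.mulVec, dotProduct, sub_mul, Finset.sum_sub_distrib, mul_assoc,
      ← Finset.mul_sum, hw, mul_zero, sub_zero]
  rw [h, ← hsum i, Finset.sum_mul]
  refine (norm_sum_le _ _).trans (Finset.sum_le_sum fun j _ => ?_)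
  rw [norm_mul, Real.norm_of_nonneg (hpos i j)]
  exact mul_le_mul_of_nonneg_left (norm_le_pi_norm w j) (hpos i j)

/-- The powers of a primitive stochastic matrix converge to the stationary vector. -/
theorem IsPrimitive.tendsto_pow {S : MarkovShift k} (hS : S.IsPrimitive) (i j : Fin k) :
    Tendsto (fun n => (S.P ^ n) i j) atTop (𝓝 (S.p j)) := by
  obtain ⟨N, -, hN⟩ := hS.exists_pos_pow
  obtain ⟨δ, hδ0, hδ⟩ : ∃ δ > 0, ∀ i j, δ ≤ (S.P ^ N) i j := by
    have : Nonempty (Fin k × Fin k) := ⟨(i, j)⟩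
    obtain ⟨q, hq⟩ := Finite.exists_min fun q : Fin k × Fin k => (S.P ^ N) q.1 q.2
    exact ⟨_, hN q.1 q.2, fun a b => hq (a, b)⟩
  set w : Fin k → ℝ := Pi.single j 1 - fun _ => S.p j with hw
  have hmean : ∀ n, S.p ⬝ᵥ ((S.P ^ n) *ᵥ w) = 0 := fun n => by
    rw [Matrix.dotProduct_mulVec, S.vecMul_pow, hw, dotProduct_sub, dotProduct_single_one]
    simp [dotProduct, ← Finset.sum_mul, S.p_mem.2]
  have hanti : Antitone fun n => ‖(S.P ^ n) *ᵥ w‖ := antitone_nat_of_succ_le fun n => by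
    have := S.norm_pow_mulVec_le (N := 1) le_rfl (fun i j => by simpa using S.nonneg i j) (hmean n)
    rwa [Matrix.mulVec_mulVec, ← pow_add, add_comm, sub_zero, one_mul] at this
  have h0 := tendsto_zero_of_antitone_of_contract hanti (fun n => norm_nonneg _)
    (N := N) (c := 1 - δ) (by linarith) fun n => by
      have := S.norm_pow_mulVec_le hδ0.le hδ (hmean n)
      rwa [Matrix.mulVec_mulVec, ← pow_add, add_comm] at this
  have h1 := (tendsto_pi_nhds.1 (tendsto_zero_iff_norm_tendsto_zero.2 h0) i).add_const (S.p j)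
  simp only [Pi.zero_apply, zero_add] at h1
  refine h1.congr fun n => ?_
  have h2 : ((S.P ^ n) *ᵥ fun _ => S.p j) i = S.p j := by
    simp only [Matrix.mulVec, dotProduct, ← Finset.sum_mul,
      Matrix.sum_row_of_mem_rowStochastic (pow_mem S.P_mem n), one_mul]
  rw [hw, Matrix.mulVec_sub, Pi.sub_apply, h2, Matrix.mulVec_single_one]
  simp

end MarkovShift

/-! ### Random products and their fibres -/

section Fibre

variable {X : Type*} [TopologicalSpace X] (f : Fin k → C(X, X))

theorem randomProduct_congr {ω ω' : ℕ → Fin k} {n : ℕ} (h : ∀ i < n, ω i = ω' i) :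
    randomProduct f ω n = randomProduct f ω' n := by
  induction n with
  | zero => rfl
  | succ n ih => rw [randomProduct, randomProduct, ih fun i hi => h i (by omega), h n (by omega)]

theorem reverseProduct_congr {ω ω' : ℕ → Fin k} {n : ℕ} (h : ∀ i < n, ω i = ω' i) :
    reverseProduct f ω n = reverseProduct f ω' n := by
  induction n with
  | zero => rfl
  | succ n ih => rw [reverseProduct, reverseProduct, ih fun i hi => h i (by omega), h n (by omega)]

theorem continuous_reverseProduct (ω : ℕ → Fin k) (n : ℕ) :
    Continuous (reverseProduct f ω n) := by
  induction n with
  | zero => exact continuous_id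
  | succ n ih => exact ih.comp (f (ω n)).continuous

theorem antitone_range_reverseProduct (ω : ℕ → Fin k) :
    Antitone fun n => Set.range (reverseProduct f ω (n + 1)) :=
  antitone_nat_of_succ_le fun _ => Set.range_comp_subset_range _ _

variable [CompactSpace X]

theorem isCompact_range_reverseProduct (ω : ℕ → Fin k) (n : ℕ) :
    IsCompact (Set.range (reverseProduct f ω n)) :=
  isCompact_range (continuous_reverseProduct f ω n)

variable [T2Space X]

theorem exists_range_reverseProduct_subset {ω : ℕ → Fin k} {U : Set X} (hU : IsOpen U)
    (h : fibre f ω ⊆ U) : ∃ n, Set.range (reverseProduct f ω (n + 1)) ⊆ U :=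
  exists_subset_nhds_of_isCompact
    (antitone_range_reverseProduct f ω).directed_ge
    (fun _ => isCompact_range_reverseProduct f ω _) fun _ hx => hU.mem_nhds (h hx)

theorem nonempty_fibre [Nonempty X] (ω : ℕ → Fin k) : (fibre f ω).Nonempty :=
  IsCompact.nonempty_iInter_of_sequence_nonempty_isCompact_isClosed _
    (fun n => antitone_range_reverseProduct f ω n.le_succ) (fun _ => Set.range_nonempty _)
    (isCompact_range_reverseProduct f ω _) fun _ => (isCompact_range_reverseProduct f ω _).isClosed

theorem isCompact_fibre (ω : ℕ → Fin k) : IsCompact (fibre f ω) :=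
  (isClosed_iInter fun _ => (isCompact_range_reverseProduct f ω _).isClosed).isCompact

/-- The fibres are connected, as decreasing intersections of continua. -/
theorem isPreconnected_fibre [PreconnectedSpace X] (ω : ℕ → Fin k) :
    IsPreconnected (fibre f ω) := by
  rw [isPreconnected_iff_subset_of_disjoint_closed]
  intro u v hu hv huv hd
  obtain ⟨u', v', hu', hv', huu, hvv, hd'⟩ :=
    SeparatedNhds.of_isCompact_isCompact ((isCompact_fibre f ω).inter_right hu)
      ((isCompact_fibre f ω).inter_right hv) (by
        rw [Set.disjoint_iff_inter_eq_empty, ← Set.inter_inter_distrib_left, hd])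
  have hsub : fibre f ω ⊆ u' ∪ v' := fun x hx => (huv hx).imp (fun h => huu ⟨hx, h⟩)
    fun h => hvv ⟨hx, h⟩
  obtain ⟨n, hn⟩ := exists_range_reverseProduct_subset f (hu'.union hv') hsub
  have hfib : fibre f ω ⊆ Set.range (reverseProduct f ω (n + 1)) := Set.iInter_subset _ n
  rcases (isPreconnected_range (continuous_reverseProduct f ω (n + 1))).subset_or_subset
    hu' hv' hd' hn with h | h
  · left
    intro x hx
    refine (huv hx).resolve_right fun hxv => ?_
    exact Set.disjoint_left.1 hd' (h (hfib hx)) (hvv ⟨hx, hxv⟩)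
  · right
    intro x hx
    refine (huv hx).resolve_left fun hxu => ?_
    exact Set.disjoint_left.1 hd' (huu ⟨hx, hxu⟩) (h (hfib hx))

theorem tendsto_codingMap {ω : ℕ → Fin k} (hω : ω ∈ weaklyHyperbolic f) (x y : X) :
    Tendsto (fun n => reverseProduct f ω (n + 1) y) atTop (𝓝 (codingMap f x ω)) := by
  obtain ⟨z, hz⟩ := hω
  have h : ∀ y, Tendsto (fun n => reverseProduct f ω (n + 1) y) atTop (𝓝 z) := by
    intro y
    rw [tendsto_nhds]
    intro U hU hzU
    obtain ⟨N, hN⟩ := exists_range_reverseProduct_subset f hU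
      (hz.trans_subset (Set.singleton_subset_iff.2 hzU))
    filter_upwards [eventually_ge_atTop N] with n hn
    exact hN (antitone_range_reverseProduct f ω hn ⟨y, rfl⟩)
  have hc : codingMap f x ω = z := (h x).limUnder_eq
  rw [hc]
  exact h y

end Fibre

/-! ### Hitting probabilities -/

section Hit

variable {X : Type*} [TopologicalSpace X] (S : MarkovShift k) (f : Fin k → C(X, X))

open Classical in
/-- For the Markov chain `i, j₁, j₂, …` of `S` started at `i`, the probability that the image of
`f_{j₁} ∘ ⋯ ∘ f_{j_n}` meets `C`, computed by conditioning on the first step: this image meets `C`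
if and only if the image of `f_{j₂} ∘ ⋯ ∘ f_{j_n}` meets the preimage of `C` under `f_{j₁}`. -/
noncomputable def hitProb : ℕ → Fin k → Set X → ℝ
  | 0, _, C => if C.Nonempty then 1 else 0
  | n + 1, i, C => ∑ j, S.P i j * hitProb n j (f j ⁻¹' C)

theorem hitProb_nonneg (n : ℕ) (i : Fin k) (C : Set X) : 0 ≤ hitProb S f n i C := by
  induction n generalizing i C with
  | zero => rw [hitProb]; split_ifs <;> norm_num
  | succ n ih => exact Finset.sum_nonneg fun j _ => mul_nonneg (S.nonneg i j) (ih _ _)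

theorem hitProb_le_one (n : ℕ) (i : Fin k) (C : Set X) : hitProb S f n i C ≤ 1 := by
  induction n generalizing i C with
  | zero => rw [hitProb]; split_ifs <;> norm_num
  | succ n ih =>
    rw [hitProb, ← S.sum_row i]
    exact Finset.sum_le_sum fun j _ => mul_le_of_le_one_right (S.nonneg i j) (ih _ _)

theorem hitProb_empty (n : ℕ) (i : Fin k) : hitProb S f n i ∅ = 0 := by
  induction n generalizing i with
  | zero => simp [hitProb]
  | succ n ih => simp [hitProb, ih]

variable {S f}

/-- Hitting probabilities are submultiplicative along a preimage invariant family of sets: the image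
of the first `a` factors has to meet the set as well. -/
theorem hitProb_add_le {𝒞 : Set (Set X)} (h𝒞 : ∀ C ∈ 𝒞, ∀ j, f j ⁻¹' C ∈ 𝒞) {b : ℕ} {c : ℝ}
    (hb : ∀ i, ∀ C ∈ 𝒞, hitProb S f b i C ≤ c) (a : ℕ) (i : Fin k) {C : Set X} (hC : C ∈ 𝒞) :
    hitProb S f (a + b) i C ≤ hitProb S f a i C * c := by
  induction a generalizing i C with
  | zero =>
    rw [zero_add, hitProb.eq_def S f 0]
    by_cases h : C.Nonempty
    · simpa [h] using hb i C hC
    · simp [Set.not_nonempty_iff_eq_empty.1 h, hitProb_empty]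
  | succ a ih =>
    rw [Nat.add_right_comm, hitProb, hitProb, Finset.sum_mul]
    refine Finset.sum_le_sum fun j _ => ?_
    rw [mul_assoc]
    exact mul_le_mul_of_nonneg_left (ih j (h𝒞 C hC j)) (S.nonneg i j)

theorem hitProb_le_of_le {a b : ℕ} (hab : a ≤ b) (i : Fin k) (C : Set X) :
    hitProb S f b i C ≤ hitProb S f a i C := by
  obtain ⟨d, rfl⟩ := Nat.exists_eq_add_of_le hab
  have := hitProb_add_le (S := S) (f := f) (𝒞 := Set.univ) (fun _ _ _ => Set.mem_univ _)
    (fun i C _ => hitProb_le_one S f d i C) a i (Set.mem_univ C)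
  rwa [mul_one] at this

theorem hitProb_succ_lt_one {n : ℕ} {i j : Fin k} {C : Set X} (hij : 0 < S.P i j)
    (h : hitProb S f n j (f j ⁻¹' C) < 1) : hitProb S f (n + 1) i C < 1 := by
  rw [hitProb, ← S.sum_row i]
  exact Finset.sum_lt_sum (fun l _ => mul_le_of_le_one_right (S.nonneg i l) (hitProb_le_one ..))
    ⟨j, Finset.mem_univ j, mul_lt_of_lt_one_right hij h⟩

/-- A hitting probability less than one is bounded away from one: it misses at least one path. -/
theorem hitProb_le_of_lt_one {ε : ℝ} (hε0 : 0 ≤ ε) (hε : ∀ i j, 0 < S.P i j → ε ≤ S.P i j)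
    {n : ℕ} {i : Fin k} {C : Set X} (h : hitProb S f n i C < 1) :
    hitProb S f n i C ≤ 1 - ε ^ n := by
  induction n generalizing i C with
  | zero =>
    rw [hitProb] at h ⊢
    split_ifs at h ⊢ with hC
    · exact absurd h (lt_irrefl 1)
    · simp
  | succ n ih =>
    obtain ⟨j, hj, hjC⟩ : ∃ j, 0 < S.P i j ∧ hitProb S f n j (f j ⁻¹' C) < 1 := by
      by_contra! hc
      refine h.not_ge ?_
      rw [hitProb, ← S.sum_row i]
      refine Finset.sum_le_sum fun j _ => ?_
      rcases (S.nonneg i j).eq_or_lt with h0 | h0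
      · rw [← h0, zero_mul]
      · exact le_mul_of_one_le_right h0.le (hc j h0)
    have h1 : 1 - hitProb S f (n + 1) i C
        = ∑ l, S.P i l * (1 - hitProb S f n l (f l ⁻¹' C)) := by
      simp only [mul_sub, mul_one, Finset.sum_sub_distrib, S.sum_row, hitProb]
    have h2 : S.P i j * (1 - hitProb S f n j (f j ⁻¹' C)) ≤ 1 - hitProb S f (n + 1) i C := by
      rw [h1]
      exact Finset.single_le_sum (f := fun l => S.P i l * (1 - hitProb S f n l (f l ⁻¹' C)))
        (fun l _ => mul_nonneg (S.nonneg i l) (sub_nonneg.2 (hitProb_le_one ..)))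
        (Finset.mem_univ j)
    have h3 : ε * ε ^ n ≤ S.P i j * (1 - hitProb S f n j (f j ⁻¹' C)) :=
      mul_le_mul (hε i j hj) (by linarith [ih hjC]) (pow_nonneg hε0 n) hj.le
    rw [pow_succ']
    linarith

/-- The word `w ++ [e]`, read backwards, is a path from `e`; along it the final image is that of `f_w`,
which misses `D`. -/
theorem hitProb_lt_one_of_word (w : List (Fin k)) (e : Fin k) (D : Set X)
    (hw : (w ++ [e]).IsChain fun i j => 0 < S.P j i) (hD : wordMap f w ⁻¹' D = ∅) :
    hitProb S f w.length e D < 1 := by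
  induction w using List.reverseRecOn generalizing e D with
  | nil =>
    have : D = ∅ := hD
    simp [this, hitProb_empty]
  | append_singleton w j ih =>
    rw [List.length_append, List.length_singleton]
    have hlast := (List.isChain_append.1 hw).2.2 j (by simp) e (by simp)
    refine hitProb_succ_lt_one hlast (ih j _ (List.isChain_append.1 hw).1 ?_)
    rw [← hD]
    ext x
    simp [wordMap]

theorem hitProb_lt_one_of_pow_pos {𝒞 : Set (Set X)} (h𝒞 : ∀ C ∈ 𝒞, ∀ j, f j ⁻¹' C ∈ 𝒞)
    {b : ℕ} {e : Fin k} (hb : ∀ C ∈ 𝒞, hitProb S f b e (f e ⁻¹' C) < 1) {n : ℕ} {i : Fin k}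
    (hn : 0 < (S.P ^ (n + 1)) i e) {C : Set X} (hC : C ∈ 𝒞) :
    hitProb S f (b + n + 1) i C < 1 := by
  induction n generalizing i C with
  | zero => exact hitProb_succ_lt_one (by simpa using hn) (hb C hC)
  | succ n ih =>
    rw [pow_succ', Matrix.mul_apply] at hn
    obtain ⟨j, -, hj⟩ := Finset.exists_lt_of_sum_lt (f := fun _ => (0 : ℝ)) (by simpa using hn)
    have h1 : 0 < S.P i j := (S.nonneg i j).lt_of_ne' (left_ne_zero_of_mul hj.ne')
    exact hitProb_succ_lt_one h1 (ih (pos_of_mul_pos_right hj h1.le) (h𝒞 C hC j))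

/-- If the words `a ++ [e]` and `b ++ [e]`, read backwards, are paths from `e`, and no set of the
preimage invariant family `𝒞` meets the images of both word maps, then the hitting probabilities of
the sets of `𝒞` decay exponentially. -/
theorem exists_hitProb_le_pow (hS : S.IsPrimitive) {a b : List (Fin k)} {e : Fin k}
    (ha : (a ++ [e]).IsChain fun i j => 0 < S.P j i)
    (hb : (b ++ [e]).IsChain fun i j => 0 < S.P j i)
    {𝒞 : Set (Set X)} (h𝒞 : ∀ C ∈ 𝒞, ∀ j, f j ⁻¹' C ∈ 𝒞)
    (hab : ∀ C ∈ 𝒞, wordMap f (a ++ [e]) ⁻¹' C = ∅ ∨ wordMap f (b ++ [e]) ⁻¹' C = ∅) :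
    ∃ N : ℕ, ∃ c : ℝ, 0 ≤ c ∧ c < 1 ∧ ∀ q i, ∀ C ∈ 𝒞, hitProb S f (q * N) i C ≤ c ^ q := by
  obtain ⟨n, hn0, hn⟩ := hS.exists_pos_pow
  obtain ⟨n, rfl⟩ := Nat.exists_eq_add_one_of_ne_zero hn0.ne'
  obtain ⟨ε, hε0, hε1, hε⟩ : ∃ ε : ℝ, 0 < ε ∧ ε ≤ 1 ∧ ∀ i j, 0 < S.P i j → ε ≤ S.P i j := by
    have : Nonempty (Fin k × Fin k) := ⟨(e, e)⟩
    obtain ⟨q, hq⟩ := Finite.exists_min fun q : Fin k × Fin k =>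
      if 0 < S.P q.1 q.2 then S.P q.1 q.2 else 1
    refine ⟨min 1 (if 0 < S.P q.1 q.2 then S.P q.1 q.2 else 1), ?_, min_le_left _ _, ?_⟩
    · split_ifs with h
      · exact lt_min one_pos h
      · simp
    · intro i j hij
      have := hq (i, j)
      simp only [hij, if_true] at this
      exact (min_le_right _ _).trans this
  have hword : ∀ (w : List (Fin k)) (C : Set X),
      wordMap f (w ++ [e]) ⁻¹' C = wordMap f w ⁻¹' (f e ⁻¹' C) := by
    intro w C
    ext x
    simp [wordMap]
  -- Started at `e` and entering through `f e`, the chain may follow either word backwards; the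
  -- words may differ in length, which the monotonicity in the number of steps absorbs.
  set L := max a.length b.length
  have hL : ∀ C ∈ 𝒞, hitProb S f L e (f e ⁻¹' C) < 1 := by
    intro C hC
    rcases hab C hC with h | h
    · exact (hitProb_le_of_le (le_max_left _ _) _ _).trans_lt
        (hitProb_lt_one_of_word a e _ ha ((hword a C).symm.trans h))
    · exact (hitProb_le_of_le (le_max_right _ _) _ _).trans_lt
        (hitProb_lt_one_of_word b e _ hb ((hword b C).symm.trans h))
  refine ⟨L + n + 1, 1 - ε ^ (L + n + 1), sub_nonneg.2 (pow_le_one₀ hε0.le hε1),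
    sub_lt_self _ (pow_pos hε0 _), fun q => ?_⟩
  induction q with
  | zero => exact fun i C _ => by simpa using hitProb_le_one S f 0 i C
  | succ q ih =>
    intro i C hC
    rw [add_mul, one_mul, add_comm (q * _), pow_succ']
    refine (hitProb_add_le h𝒞 ih _ i hC).trans
      (mul_le_mul_of_nonneg_right ?_ (pow_nonneg (sub_nonneg.2 (pow_le_one₀ hε0.le hε1)) q))
    exact hitProb_le_of_lt_one hε0.le hε (hitProb_lt_one_of_pow_pos h𝒞 hL (hn i e) hC)

variable (S f)

/-- The recursive hitting probabilities are the actual ones. Letters are traded one at a time, by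
the Markov property, for one more step in `hitProb`. -/
theorem measureReal_range_reverseProduct_inter (n : ℕ) (C : Set X) :
    S.measure.real {ω | (Set.range (reverseProduct f ω (n + 1)) ∩ C).Nonempty}
      = ∫ ω, hitProb S f n (ω 0) (f (ω 0) ⁻¹' C) ∂S.measure := by
  have hstep : ∀ r n, ∫ ω, hitProb S f n (ω (r + 1)) (reverseProduct f ω (r + 2) ⁻¹' C) ∂S.measure
      = ∫ ω, hitProb S f (n + 1) (ω r) (reverseProduct f ω (r + 1) ⁻¹' C) ∂S.measure := by
    intro r n
    refine S.integral_succ r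
      (fun ω j => hitProb S f n j (f j ⁻¹' (reverseProduct f ω (r + 1) ⁻¹' C))) fun j ω ω' h => ?_
    simp only
    rw [reverseProduct_congr f fun i hi => h i (Nat.lt_succ_iff.1 hi)]
  have hiter : ∀ r n, ∫ ω, hitProb S f n (ω r) (reverseProduct f ω (r + 1) ⁻¹' C) ∂S.measure
      = ∫ ω, hitProb S f (n + r) (ω 0) (reverseProduct f ω 1 ⁻¹' C) ∂S.measure := by
    intro r
    induction r with
    | zero => exact fun _ => rfl
    | succ r ih => exact fun n => by rw [hstep, ih, add_right_comm, add_assoc]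
  have hmeas : MeasurableSet {ω | (Set.range (reverseProduct f ω (n + 1)) ∩ C).Nonempty} := by
    refine measurableSet_setOfPred.2 (measurable_of_dependsOn (r := n) fun ω ω' h => ?_)
    rw [reverseProduct_congr f fun i hi => h i (Nat.lt_succ_iff.1 hi)]
  have h0 := hiter n 0
  rw [zero_add] at h0
  refine Eq.trans ?_ h0
  rw [← integral_indicator_one hmeas]
  refine integral_congr_ae (ae_of_all _ fun ω => ?_)
  have hiff : ω ∈ {ω | (Set.range (reverseProduct f ω (n + 1)) ∩ C).Nonempty}
      ↔ (reverseProduct f ω (n + 1) ⁻¹' C).Nonempty := by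
    change (Set.range (reverseProduct f ω (n + 1)) ∩ C).Nonempty ↔ _
    rw [Set.inter_comm]
    simp [Set.Nonempty]
  by_cases h : (reverseProduct f ω (n + 1) ⁻¹' C).Nonempty
  · simp only [hitProb, if_pos h]
    exact Set.indicator_of_mem (hiff.2 h) _
  · simp only [hitProb, if_neg h]
    exact Set.indicator_of_notMem (fun h' => h (hiff.1 h')) _

end Hit

/-- Almost every fibre misses a given set of a preimage invariant family as in
`exists_hitProb_le_pow`. -/
theorem ae_exists_range_reverseProduct_disjoint {X : Type*} [TopologicalSpace X]
    {S : MarkovShift k} {f : Fin k → C(X, X)} (hS : S.IsPrimitive)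
    {a b : List (Fin k)} {e : Fin k}
    (ha : (a ++ [e]).IsChain fun i j => 0 < S.P j i)
    (hb : (b ++ [e]).IsChain fun i j => 0 < S.P j i)
    {𝒞 : Set (Set X)} (h𝒞 : ∀ C ∈ 𝒞, ∀ j, f j ⁻¹' C ∈ 𝒞)
    (hab : ∀ C ∈ 𝒞, wordMap f (a ++ [e]) ⁻¹' C = ∅ ∨ wordMap f (b ++ [e]) ⁻¹' C = ∅)
    {C : Set X} (hC : C ∈ 𝒞) :
    ∀ᵐ ω ∂S.measure, ∃ n, ¬ (Set.range (reverseProduct f ω (n + 1)) ∩ C).Nonempty := by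
  obtain ⟨N, c, hc0, hc1, hc⟩ := exists_hitProb_le_pow hS ha hb h𝒞 hab
  rw [ae_iff]
  push Not
  rw [← measureReal_eq_zero_iff]
  refine le_antisymm ?_ measureReal_nonneg
  refine ge_of_tendsto' (tendsto_pow_atTop_nhds_zero_of_lt_one hc0 hc1) fun q => ?_
  refine (measureReal_mono
    (s₂ := {ω | (Set.range (reverseProduct f ω (q * N + 1)) ∩ C).Nonempty}) ?_).trans ?_
  · exact fun ω hω => hω (q * N)
  rw [measureReal_range_reverseProduct_inter]
  refine (integral_mono (g := fun _ => c ^ q) ?_ (integrable_const _) fun ω =>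
    hc q _ _ (h𝒞 C hC _)).trans (by simp)
  exact integrable_of_dependsOn _ (r := 0) fun ω ω' h => by rw [h 0 (Set.mem_Iic.2 le_rfl)]

/-! ### The dual of the Markov operator -/

section Dual

variable {X : Type*} [TopologicalSpace X] (S : MarkovShift k) (f : Fin k → C(X, X))

/-- The dual of the Markov operator, acting on continuous functions:
`(i, z) ↦ ∑ j, P i j * φ (j, f j z)`. -/
noncomputable def dualOperator (φ : C(Fin k × X, ℝ)) : C(Fin k × X, ℝ) where
  toFun q := ∑ j, S.P q.1 j * φ (j, f j q.2)
  continuous_toFun := continuous_finsetSum _ fun j _ =>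
    (continuous_of_discreteTopology (f := fun i => S.P i j)).comp continuous_fst
      |>.mul (by fun_prop)

theorem dualOperator_apply (φ : C(Fin k × X, ℝ)) (q : Fin k × X) :
    dualOperator S f φ q = ∑ j, S.P q.1 j * φ (j, f j q.2) := rfl

theorem abs_iterate_dualOperator_le {φ : C(Fin k × X, ℝ)} {K : ℝ} (hφ : ∀ q, |φ q| ≤ K) (n : ℕ)
    (q : Fin k × X) : |(dualOperator S f)^[n] φ q| ≤ K := by
  induction n generalizing q with
  | zero => exact hφ q
  | succ n ih =>
    rw [Function.iterate_succ_apply', dualOperator_apply]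
    calc |∑ j, S.P q.1 j * (dualOperator S f)^[n] φ (j, f j q.2)|
        ≤ ∑ j, S.P q.1 j * K := by
          refine (Finset.abs_sum_le_sum_abs _ _).trans (Finset.sum_le_sum fun j _ => ?_)
          rw [abs_mul, abs_of_nonneg (S.nonneg q.1 j)]
          exact mul_le_mul_of_nonneg_left (ih _) (S.nonneg q.1 j)
      _ = K := by rw [← Finset.sum_mul, S.sum_row, one_mul]

/-- Time reversal: running the chain of `S` forward from `i` for `n` steps amounts to reading the
inverse chain backwards from `ω n = i`, and turns random products into reversed products. -/
theorem mul_iterate_dualOperator (hp : ∀ i, 0 < S.p i) (φ : C(Fin k × X, ℝ)) (n : ℕ) (i : Fin k)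
    (z : X) :
    S.p i * (dualOperator S f)^[n] φ (i, z)
      = ∫ ω, φ (ω 0, reverseProduct f ω n z) * (if ω n = i then 1 else 0)
          ∂(S.inverse hp).measure := by
  induction n generalizing i z with
  | zero =>
    refine Eq.trans ?_ ((S.inverse hp).integral_eval_zero
      fun j => φ (j, z) * (if j = i then 1 else 0)).symm
    simp [MarkovShift.inverse]
  | succ n ih =>
    have hg : ∀ y, DependsOn (fun ω : ℕ → Fin k => φ (ω 0, reverseProduct f ω n y))
        (Set.Iic n) := fun y ω ω' h => by
      simp only
      rw [h 0 (Set.mem_Iic.2 (Nat.zero_le n)), reverseProduct_congr f fun i hi => h i hi.le]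
    have h1 := (S.inverse hp).integral_succ n
      (fun ω j => φ (ω 0, reverseProduct f ω n (f (ω n) z)) * (if j = i then 1 else 0))
      fun j ω ω' h => by
        simp only
        rw [h n (Set.mem_Iic.2 le_rfl)]
        exact congrArg (· * _) (hg (f (ω' n) z) h)
    refine Eq.trans ?_ h1.symm
    have h2 : ∀ ω : ℕ → Fin k, ∑ j, (S.inverse hp).P (ω n) j *
          (φ (ω 0, reverseProduct f ω n (f (ω n) z)) * (if j = i then 1 else 0))
        = ∑ l, (S.p i / S.p l * S.P i l) *
          (φ (ω 0, reverseProduct f ω n (f l z)) * (if ω n = l then 1 else 0)) := fun ω => by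
      simp [MarkovShift.inverse]
    simp only [h2]
    rw [integral_finsetSum]
    · simp only [integral_const_mul, ← ih]
      rw [Function.iterate_succ_apply', dualOperator_apply, Finset.mul_sum]
      refine Finset.sum_congr rfl fun l _ => ?_
      have := (hp l).ne'
      field_simp
    · intro l _
      refine (integrable_of_dependsOn _ (r := n) fun ω ω' h => ?_).const_mul _
      rw [h n (Set.mem_Iic.2 le_rfl)]
      exact congrArg (· * _) (hg (f l z) h)

/-- If the reversed products converge almost surely for the inverse Markov measure, then the
iterates of the dual operator converge to the integral of the limit. Time reversal writes the `n`-th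
iterate at `(i, z)` as an expectation conditioned on `ω n = i`, and since the inverse chain is
mixing this conditioning is asymptotically irrelevant. -/
theorem tendsto_iterate_dualOperator [CompactSpace X] [TopologicalSpace.PseudoMetrizableSpace X]
    [MeasurableSpace X] [BorelSpace X] {S : MarkovShift k} (hS : S.IsPrimitive)
    (f : Fin k → C(X, X)) {π : (ℕ → Fin k) → X} (z : X)
    (hπ : ∀ᵐ ω ∂(S.inverse hS.pos).measure,
      Tendsto (fun n => reverseProduct f ω n z) atTop (𝓝 (π ω)))
    (φ : C(Fin k × X, ℝ)) (i : Fin k) :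
    Tendsto (fun n => (dualOperator S f)^[n] φ (i, z)) atTop
      (𝓝 (∫ ω, φ (ω 0, π ω) ∂(S.inverse hS.pos).measure)) := by
  set μ := (S.inverse hS.pos).measure
  set g : ℕ → (ℕ → Fin k) → ℝ := fun n ω => φ (ω 0, reverseProduct f ω n z) with hg
  set G : (ℕ → Fin k) → ℝ := fun ω => φ (ω 0, π ω)
  have hdep : ∀ n, DependsOn (g n) (Set.Iic n) := fun n ω ω' h => by
    simp only [hg]
    rw [h 0 (Set.mem_Iic.2 (Nat.zero_le n)), reverseProduct_congr f fun i hi => h i hi.le]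
  have hgm : ∀ n, AEStronglyMeasurable (g n) μ := fun n =>
    (measurable_of_dependsOn (hdep n)).aestronglyMeasurable
  have hlim : ∀ᵐ ω ∂μ, Tendsto (fun n => g n ω) atTop (𝓝 (G ω)) := by
    filter_upwards [hπ] with ω hω
    exact (φ.continuous.tendsto _).comp (tendsto_const_nhds.prodMk_nhds hω)
  have hGm : AEStronglyMeasurable G μ := aestronglyMeasurable_of_tendsto_ae atTop hgm hlim
  have hbd : ∀ q, |φ q| ≤ ‖φ‖ := fun q => φ.norm_coe_le_norm q
  have hgi : ∀ n, Integrable (g n) μ := fun n => integrable_of_dependsOn μ (hdep n)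
  have hGi : Integrable G μ := .of_bound hGm ‖φ‖ (ae_of_all _ fun ω => hbd _)
  set a : ℕ → ℝ := fun n => ∫ ω, |g n ω - G ω| ∂μ with ha
  have ha0 : Tendsto a atTop (𝓝 0) := by
    have h := tendsto_integral_of_dominated_convergence (μ := μ)
      (F := fun n ω => |g n ω - G ω|) (f := fun _ => 0) (fun _ => ‖φ‖ + ‖φ‖)
      (fun n => ((hgm n).sub hGm).norm) (integrable_const _)
      (fun n => ae_of_all _ fun ω => by
        rw [Real.norm_eq_abs, abs_abs]
        exact (abs_sub _ _).trans (add_le_add (hbd _) (hbd _)))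
      (by
        filter_upwards [hlim] with ω hω
        have := (hω.sub_const (G ω)).abs
        rwa [sub_self, abs_zero] at this)
    simpa using h
  set e : ℕ → (ℕ → Fin k) → ℝ := fun n ω => if ω n = i then 1 else 0 with he
  have hem : ∀ n, AEStronglyMeasurable (e n) μ := fun n =>
    (measurable_of_dependsOn (r := n) fun ω ω' h => by
      simp only [he, h n (Set.mem_Iic.2 le_rfl)]).aestronglyMeasurable
  have he1 : ∀ n ω, |e n ω| ≤ 1 := fun n ω => by
    simp only [he]; split_ifs <;> simp
  have hgei : ∀ r n, Integrable (fun ω => g r ω * e n ω) μ := fun r n =>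
    (hgi r).mul_bdd (hem n) (ae_of_all _ fun ω => he1 n ω)
  -- For fixed `r`, the event `ω n = i` becomes independent of the first `r` letters.
  have hmix : ∀ r, Tendsto (fun n => ∫ ω, g r ω * e n ω ∂μ) atTop
      (𝓝 ((∫ ω, g r ω ∂μ) * S.p i)) := by
    intro r
    rw [← tendsto_add_atTop_iff_nat r, ← integral_mul_const]
    have h1 : ∀ m, ∫ ω, g r ω * e (m + r) ω ∂μ
        = ∫ ω, g r ω * ((S.inverse hS.pos).P ^ m) (ω r) i ∂μ := fun m => by
      have := (S.inverse hS.pos).integral_add r m (g r) (hdep r) (Pi.single i 1)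
      simp only [Matrix.mulVec_single_one, Pi.single_apply] at this
      rw [add_comm m r]
      exact this
    simp only [h1]
    refine tendsto_integral_of_dominated_convergence (fun _ => ‖φ‖)
      (fun m => (hgm r).mul (measurable_of_dependsOn (r := r) fun ω ω' h => by
        rw [h r (Set.mem_Iic.2 le_rfl)]).aestronglyMeasurable)
      (integrable_const _) (fun m => ae_of_all _ fun ω => ?_)
      (ae_of_all _ fun ω => (hS.inverse.tendsto_pow (ω r) i).const_mul _)
    have hst := pow_mem (S.inverse hS.pos).P_mem m
    rw [norm_mul, Real.norm_of_nonneg (hst.1 _ _)]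
    refine (mul_le_of_le_one_right (norm_nonneg _) ?_).trans (hbd _)
    rw [← Matrix.sum_row_of_mem_rowStochastic hst (ω r)]
    exact Finset.single_le_sum (fun l _ => hst.1 (ω r) l) (Finset.mem_univ i)
  -- Replacing `g n` by `g r` on the event `ω n = i` costs at most `a n + a r`, for any event.
  have hmain : Tendsto (fun n => ∫ ω, g n ω * e n ω ∂μ) atTop (𝓝 ((∫ ω, G ω ∂μ) * S.p i)) := by
    rw [Metric.tendsto_atTop]
    intro ε hε
    obtain ⟨r, hr⟩ := (Metric.tendsto_atTop.1 ha0) (ε / 4) (by positivity)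
    have har : ∀ n ≥ r, a n < ε / 4 := fun n hn => by
      have := hr n hn
      rw [Real.dist_eq, sub_zero] at this
      exact (le_abs_self _).trans_lt this
    obtain ⟨N, hN⟩ := (Metric.tendsto_atTop.1 (hmix r)) (ε / 4) (by positivity)
    refine ⟨max r N, fun n hn => ?_⟩
    have h1 : |∫ ω, g n ω * e n ω ∂μ - ∫ ω, g r ω * e n ω ∂μ| ≤ a n + a r := by
      have h0 : a n + a r = ∫ ω, (|g n ω - G ω| + |g r ω - G ω|) ∂μ :=
        (integral_add ((hgi n).sub hGi).abs ((hgi r).sub hGi).abs).symm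
      rw [← integral_sub (hgei n n) (hgei r n), h0]
      refine (abs_integral_le_integral_abs).trans (integral_mono ((hgei n n).sub (hgei r n)).abs
        (((hgi n).sub hGi).abs.add ((hgi r).sub hGi).abs) fun ω => ?_)
      simp only [← sub_mul, abs_mul]
      refine (mul_le_of_le_one_right (abs_nonneg _) (he1 n ω)).trans ?_
      have := abs_sub_le (g n ω) (G ω) (g r ω)
      rwa [abs_sub_comm (G ω)] at this
    have h2 : |∫ ω, g r ω ∂μ - ∫ ω, G ω ∂μ| ≤ a r := by
      rw [← integral_sub (hgi r) hGi]
      exact abs_integral_le_integral_abs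
    have h3 : |(∫ ω, g r ω ∂μ) * S.p i - (∫ ω, G ω ∂μ) * S.p i| ≤ a r := by
      rw [← sub_mul, abs_mul, abs_of_pos (hS.pos i)]
      refine (mul_le_of_le_one_right (abs_nonneg _) ?_).trans h2
      exact S.p_mem.2 ▸ Finset.single_le_sum (fun l _ => S.p_mem.1 l) (Finset.mem_univ i)
    have h4 := hN n ((le_max_right _ _).trans hn)
    have h5 := har n ((le_max_left _ _).trans hn)
    have h6 := har r le_rfl
    rw [Real.dist_eq] at h4 ⊢
    rw [abs_lt] at h4 ⊢
    rw [abs_le] at h1 h3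
    constructor <;> linarith [h1.1, h1.2, h3.1, h3.2, h4.1, h4.2]
  have hdiv := hmain.div_const (S.p i)
  rw [mul_div_cancel_right₀ _ (hS.pos i).ne'] at hdiv
  refine hdiv.congr fun n => ?_
  rw [← mul_iterate_dualOperator S f hS.pos φ n i z, mul_div_cancel_left₀ _ (hS.pos i).ne']

variable [CompactSpace X] [MeasurableSpace X] [BorelSpace X]

theorem integrable_continuousMap {Z : Type*} [TopologicalSpace Z] [CompactSpace Z]
    [MeasurableSpace Z] [OpensMeasurableSpace Z] (ν : Measure Z) [IsFiniteMeasure ν] (φ : C(Z, ℝ)) :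
    Integrable φ ν :=
  .of_bound φ.continuous.aestronglyMeasurable ‖φ‖ (ae_of_all _ φ.norm_coe_le_norm)

theorem integral_markovOperator (μ : ProbabilityMeasure (Fin k × X)) (φ : C(Fin k × X, ℝ)) :
    ∫ q, φ q ∂(markovOperator S f μ : Measure (Fin k × X))
      = ∫ q, dualOperator S f φ q ∂(μ : Measure (Fin k × X)) := by
  have h : (markovOperator S f μ : Measure (Fin k × X))
    = (productKernel S f) ∘ₘ (μ : Measure (Fin k × X)) := rfl
  have hi := integrable_continuousMap (markovOperator S f μ : Measure (Fin k × X)) φ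
  rw [h] at hi ⊢
  have hc := Kernel.integral_comp (η := productKernel S f)
    (κ := Kernel.const Unit (μ : Measure (Fin k × X))) (a := ()) (f := φ)
    (by rwa [Kernel.comp_apply, Kernel.const_apply])
  rw [Kernel.comp_apply, Kernel.const_apply] at hc
  rw [hc]
  refine integral_congr_ae (ae_of_all _ fun q => ?_)
  change ∫ y, φ y ∂((S.stepKernel q.1).map fun j => (j, f j q.2)) = _
  rw [integral_map (measurable_of_countable _).aemeasurable φ.continuous.aestronglyMeasurable]
  exact integral_vectorMeasure (S.nonneg q.1) _

theorem integral_iterate_markovOperator (n : ℕ) (μ : ProbabilityMeasure (Fin k × X))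
    (φ : C(Fin k × X, ℝ)) :
    ∫ q, φ q ∂((markovOperator S f)^[n] μ : Measure (Fin k × X))
      = ∫ q, (dualOperator S f)^[n] φ q ∂(μ : Measure (Fin k × X)) := by
  induction n generalizing μ with
  | zero => rfl
  | succ n ih => rw [Function.iterate_succ_apply, ih, integral_markovOperator,
      Function.iterate_succ_apply']

theorem tendsto_iff_forall_continuousMap {Z : Type*} [TopologicalSpace Z] [CompactSpace Z]
    [MeasurableSpace Z] [OpensMeasurableSpace Z] {ν : ℕ → ProbabilityMeasure Z}
    {μ : ProbabilityMeasure Z} :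
    Tendsto ν atTop (𝓝 μ) ↔ ∀ φ : C(Z, ℝ),
      Tendsto (fun n => ∫ q, φ q ∂(ν n : Measure Z)) atTop (𝓝 (∫ q, φ q ∂(μ : Measure Z))) := by
  rw [ProbabilityMeasure.tendsto_iff_forall_integral_tendsto]
  exact ⟨fun h φ => h (BoundedContinuousFunction.mkOfCompact φ), fun h φ => h φ.toContinuousMap⟩

/-- A measure against which the iterates of the dual operator equidistribute pointwise is a stable
limit; it is stationary because the Markov operator is weakly continuous. -/
theorem isStableLimit_of_tendsto_dualOperator [TopologicalSpace.PseudoMetrizableSpace X]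
    {μ : ProbabilityMeasure (Fin k × X)}
    (h : ∀ (φ : C(Fin k × X, ℝ)) (q : Fin k × X),
      Tendsto (fun n => (dualOperator S f)^[n] φ q) atTop
        (𝓝 (∫ q, φ q ∂(μ : Measure (Fin k × X))))) :
    IsStableLimit (markovOperator S f) μ := by
  have hlim : ∀ ν, Tendsto (fun n => (markovOperator S f)^[n] ν) atTop (𝓝 μ) := by
    intro ν
    rw [tendsto_iff_forall_continuousMap]
    intro φ
    simp only [integral_iterate_markovOperator]
    have := tendsto_integral_of_dominated_convergence (μ := (ν : Measure (Fin k × X)))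
      (F := fun n q => (dualOperator S f)^[n] φ q)
      (f := fun _ => ∫ q, φ q ∂(μ : Measure (Fin k × X))) (fun _ => ‖φ‖)
      (fun n => ((dualOperator S f)^[n] φ).continuous.aestronglyMeasurable) (integrable_const _)
      (fun n => ae_of_all _ fun q => abs_iterate_dualOperator_le S f φ.norm_coe_le_norm n q)
      (ae_of_all _ fun q => h φ q)
    simpa using this
  refine ⟨?_, hlim⟩
  have hT : Tendsto (fun n => (markovOperator S f)^[n + 1] μ) atTop (𝓝 (markovOperator S f μ)) := by
    rw [tendsto_iff_forall_continuousMap]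
    intro φ
    simp only [Function.iterate_succ_apply', integral_markovOperator]
    exact tendsto_iff_forall_continuousMap.1 (hlim μ) (dualOperator S f φ)
  exact tendsto_nhds_unique hT ((tendsto_add_atTop_iff_nat 1).2 (hlim μ))

end Dual

/-! ### Weak hyperbolicity of almost every sequence -/

/-- A fibre with two points has a nondegenerate connected projection to some coordinate, which
contains a point of a given countable dense set; but the projections of almost every fibre miss that
set. -/
theorem Splits.ae_mem_weaklyHyperbolic {Y : Type*} [MetricSpace Y]
    [TopologicalSpace.SeparableSpace Y]
    (hY : ∀ C : Set Y, IsConnected C → C.Nontrivial → (interior C).Nonempty)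
    {m : ℕ} {M : Set (Fin m → Y)} (hMcompact : IsCompact M) (hMconn : IsConnected M)
    {S : MarkovShift k} (hS : S.IsPrimitive) {f : Fin k → C(M, M)} (hf : Splits S f) :
    ∀ᵐ ω ∂(S.inverse hS.pos).measure, ω ∈ weaklyHyperbolic f := by
  have : CompactSpace M := isCompact_iff_compactSpace.1 hMcompact
  have : ConnectedSpace M := isConnected_iff_connectedSpace.1 hMconn
  obtain ⟨a, b, ha, hb, hPa, hPb, hlast, hdisj⟩ := hf
  obtain ⟨a, e, rfl⟩ : ∃ l x, a = l ++ [x] := ⟨_, _, (List.dropLast_concat_getLast ha).symm⟩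
  obtain ⟨b, e', rfl⟩ : ∃ l x, b = l ++ [x] := ⟨_, _, (List.dropLast_concat_getLast hb).symm⟩
  obtain rfl : e = e' := by simpa using hlast
  have hadm : ∀ w, Admissible S.P w → w.IsChain fun i j => 0 < (S.inverse hS.pos).P j i :=
    fun w hw => hw.imp fun i j hij => mul_pos (div_pos (hS.pos i) (hS.pos j)) hij
  -- A preimage invariant family of sets that meet at most one of the two images; the splitting
  -- condition puts the hyperplanes `{x | x s = d}` into it.
  set 𝒞 : Set (Set M) := {C | ∀ (ω : ℕ → Fin k) (n : ℕ),
    randomProduct f ω n '' (wordMap f (a ++ [e]) '' Set.univ) ∩ C = ∅ ∨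
    randomProduct f ω n '' (wordMap f (b ++ [e]) '' Set.univ) ∩ C = ∅}
  have hinv : ∀ C ∈ 𝒞, ∀ j, f j ⁻¹' C ∈ 𝒞 := by
    intro C hC j ω n
    have h1 : randomProduct f (Function.update ω n j) (n + 1) = f j ∘ randomProduct f ω n := by
      rw [randomProduct, Function.update_self, randomProduct_congr f (ω' := ω) fun i hi =>
        Function.update_of_ne hi.ne _ _]
    have h2 := hC (Function.update ω n j) (n + 1)
    rw [h1, Set.image_comp, Set.image_comp] at h2
    simpa only [← Set.image_inter_preimage, Set.image_eq_empty] using h2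
  have hmiss : ∀ C ∈ 𝒞, wordMap f (a ++ [e]) ⁻¹' C = ∅ ∨ wordMap f (b ++ [e]) ⁻¹' C = ∅ := by
    intro C hC
    have h := hC (fun _ => e) 0
    simpa only [randomProduct, Set.image_id, ← Set.image_inter_preimage, Set.image_eq_empty,
      Set.univ_inter] using h
  have hplane : ∀ (s : Fin m) (d : Y), {x : M | (x : Fin m → Y) s = d} ∈ 𝒞 := by
    intro s d ω n
    by_contra! hc
    obtain ⟨⟨x, hx, hxd⟩, y, hy, hyd⟩ := hc
    exact Set.disjoint_left.1 (hdisj ω n s) ⟨x, hx, hxd⟩ ⟨y, hy, hyd⟩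
  obtain ⟨D, hDc, hD⟩ := TopologicalSpace.exists_countable_dense Y
  have hae : ∀ᵐ ω ∂(S.inverse hS.pos).measure, ∀ (s : Fin m), ∀ d ∈ D,
      ∃ n, ¬ (Set.range (reverseProduct f ω (n + 1)) ∩
        {x : M | (x : Fin m → Y) s = d}).Nonempty := by
    rw [ae_all_iff]
    intro s
    rw [ae_ball_iff hDc]
    exact fun d _ => ae_exists_range_reverseProduct_disjoint hS.inverse (hadm _ hPa) (hadm _ hPb)
      hinv hmiss (hplane s d)
  filter_upwards [hae] with ω hω
  obtain ⟨z, hz⟩ := nonempty_fibre f ω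
  refine ⟨z, Set.eq_singleton_iff_unique_mem.2 ⟨hz, fun y hy => ?_⟩⟩
  by_contra hne
  obtain ⟨s, hs⟩ : ∃ s, (y : Fin m → Y) s ≠ (z : Fin m → Y) s := by
    by_contra! h
    exact hne (Subtype.ext (funext h))
  have hconn : IsConnected ((fun x : M => (x : Fin m → Y) s) '' fibre f ω) :=
    ⟨⟨_, z, hz, rfl⟩, (isPreconnected_fibre f ω).image _
      ((continuous_apply s).comp continuous_subtype_val).continuousOn⟩
  obtain ⟨d, hdint, hdD⟩ := hD.inter_open_nonempty _ isOpen_interior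
    (hY _ hconn ⟨_, ⟨y, hy, rfl⟩, _, ⟨z, hz, rfl⟩, hs⟩)
  obtain ⟨x, hx, hxd⟩ := interior_subset hdint
  obtain ⟨n, hn⟩ := hω s d hdD
  exact hn ⟨x, Set.mem_iInter.1 hx n, hxd⟩

theorem aemeasurable_codingMap {X : Type*} [TopologicalSpace X] [CompactSpace X] [T2Space X]
    [TopologicalSpace.PseudoMetrizableSpace X] [MeasurableSpace X] [BorelSpace X]
    {f : Fin k → C(X, X)} {ν : Measure (ℕ → Fin k)} (hν : ∀ᵐ ω ∂ν, ω ∈ weaklyHyperbolic f) (x : X) :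
    AEMeasurable (codingMap f x) ν := by
  refine aemeasurable_of_tendsto_metrizable_ae atTop
    (f := fun n ω => reverseProduct f ω (n + 1) x) (fun n => ?_) ?_
  · exact (measurable_of_dependsOn (r := n) fun ω ω' h => by
      rw [reverseProduct_congr f fun i hi => h i (Nat.lt_succ_iff.1 hi)]).aemeasurable
  · filter_upwards [hν] with ω hω
    exact tendsto_codingMap f hω x x

end MarkovProduct

theorem theorem1 {Y : Type*} [MetricSpace Y] [TopologicalSpace.SeparableSpace Y]
    [MeasurableSpace Y] [BorelSpace Y]
    (hY : ∀ C : Set Y, IsConnected C → C.Nontrivial → (interior C).Nonempty)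
    {m : ℕ} (hm : 1 ≤ m) (M : Set (Fin m → Y)) (hMcompact : IsCompact M) (hMconn : IsConnected M)
    {k : ℕ} (S : MarkovProduct.MarkovShift k) (hS : S.IsPrimitive)
    (f : Fin k → C(M, M)) (hf : MarkovProduct.Splits S f) :
    -- asymptotic stability, with a unique stationary measure `μ`
    ∃ μ : ProbabilityMeasure (Fin k × M),
      MarkovProduct.IsStableLimit (MarkovProduct.markovOperator S f) μ ∧
      (∀ ν : ProbabilityMeasure (Fin k × M), MarkovProduct.markovOperator S f ν = ν → ν = μ) ∧
      -- the coding map is defined almost everywhere for the inverse Markov measure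
      (∀ᵐ ω ∂(S.inverse hS.pos).measure, ω ∈ MarkovProduct.weaklyHyperbolic f) ∧
      (∀ x y : M, ∀ ω ∈ MarkovProduct.weaklyHyperbolic f,
        Tendsto (fun n : ℕ => MarkovProduct.reverseProduct f ω (n + 1) y) atTop
          (𝓝 (MarkovProduct.codingMap f x ω))) ∧
      -- `μ` is the pushforward of the inverse Markov measure by `ω ↦ (ω 0, π ω)`
      ∀ x : M,
        AEMeasurable (fun ω : ℕ → Fin k => (ω 0, MarkovProduct.codingMap f x ω))
          (S.inverse hS.pos).measure ∧
        (μ : Measure (Fin k × M)) = (S.inverse hS.pos).measure.map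
          (fun ω : ℕ → Fin k => (ω 0, MarkovProduct.codingMap f x ω)) := by
  have : CompactSpace M := isCompact_iff_compactSpace.1 hMcompact
  obtain ⟨x₀⟩ : Nonempty M := hMconn.nonempty.to_subtype
  have hae := MarkovProduct.Splits.ae_mem_weaklyHyperbolic hY hMcompact hMconn hS hf
  have hmeas : ∀ x : M, AEMeasurable (fun ω : ℕ → Fin k => (ω 0, MarkovProduct.codingMap f x ω))
      (S.inverse hS.pos).measure := fun x =>
    (measurable_pi_apply 0).aemeasurable.prodMk (MarkovProduct.aemeasurable_codingMap hae x)
  set μ : ProbabilityMeasure (Fin k × M) := ⟨(S.inverse hS.pos).measure.map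
    (fun ω : ℕ → Fin k => (ω 0, MarkovProduct.codingMap f x₀ ω)),
    Measure.isProbabilityMeasure_map (hmeas x₀)⟩
  have hstable : MarkovProduct.IsStableLimit (MarkovProduct.markovOperator S f) μ := by
    refine MarkovProduct.isStableLimit_of_tendsto_dualOperator S f fun φ q => ?_
    have h : ∫ q, φ q ∂(μ : Measure (Fin k × M)) = ∫ ω, φ (ω 0, MarkovProduct.codingMap f x₀ ω)
        ∂(S.inverse hS.pos).measure :=
      integral_map (hmeas x₀) φ.continuous.aestronglyMeasurable
    rw [h]
    refine MarkovProduct.tendsto_iterate_dualOperator hS f q.2 ?_ φ q.1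
    filter_upwards [hae] with ω hω
    exact (tendsto_add_atTop_iff_nat 1).1 (MarkovProduct.tendsto_codingMap f hω x₀ q.2)
  refine ⟨μ, hstable, fun ν hν => ?_, hae, fun x y ω hω => MarkovProduct.tendsto_codingMap f hω x y,
    fun x => ⟨hmeas x, ?_⟩⟩
  · have h := hstable.2 ν
    simp only [Function.iterate_fixed hν] at h
    exact tendsto_nhds_unique tendsto_const_nhds h
  · refine Measure.map_congr ?_
    filter_upwards [hae] with ω hω
    rw [tendsto_nhds_unique (MarkovProduct.tendsto_codingMap f hω x₀ x₀)
      (MarkovProduct.tendsto_codingMap f hω x x₀)]
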